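/- Let $K$ transmission links share $N$ carriers. Let $g_{kln}>0$ be the power gain on carrier $n$ from transmitter $l$ to receiver $k$, $\sigma_{kn}^2>0$ the noise powers, $\Gamma>0$ the SINR gap, $w_k>0$ the rate weights, $P^{\rm tot}_k>0$ the power budgets and $P^{\rm mask}_{kn}>0$ the spectral masks. For a power allocation $P=(p_{kn})$ put $$\gamma_{kn}(P)=\frac{g_{kkn}p_{kn}}{\sigma^2_{kn}+\sum_{l\ne k}g_{kln}p_{ln}},\qquad g(P)=\sum_{k,n}w_k\log\Big(1+\frac{\gamma_{kn}(P)}{\Gamma}\Big).$$ The WSR problem is to maximize $g$ over the set $\mathcal P$ of all $P$ with $\sum_n p_{kn}\le P^{\rm tot}_k$ for all $k$ and $0\le p_{kn}\le P^{\rm mask}_{kn}$ for all $k,n$. The log-SINR matrix of $P\in\mathcal P$ is $\phi(P)=(\log\gamma_{kn}(P))_{kn}$, with entry $-\infty$ where $p_{kn}=0$. Let $\Phi=\{\phi(P): P\in\mathcal P\}$ (so the entries of its points lie in $[-\infty,\infty)$), $f(\phi)=\sum_{k,n}w_k\log(1+e^{\phi_{kn}}/\Gamma)$, so that $f(\phi(P))=g(P)$,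 and $\partial_{kn}f(\phi)=w_ke^{\phi_{kn}}/(\Gamma+e^{\phi_{kn}})$, which is $0$ when $\phi_{kn}=-\infty$. With the convention $0\cdot(-\infty)=0$, let $$\mathcal S=\Big\{\phi'\in\Phi:\ \sum_{k,n}\partial_{kn}f(\phi')\,\phi_{kn}\le\sum_{k,n}\partial_{kn}f(\phi')\,\phi'_{kn}\ \text{ for all }\phi\in\Phi\Big\}$$ be the set of fixed points (stationary points) of the SCALE iteration, zero powers allowed, and let $\Phi^\star$ be the set of global maximizers of $f$ over $\Phi$. The SCALE algorithm starts at an entrywise positive $P^{(1)}\in\mathcal P$, and for every $m\ge1$ the iterate $P^{(m+1)}$ is a global maximizer over $P\in\mathcal P$ of $$g^{(m)}(P)=g(P^{(m)})+\sum_{k,n}\frac{w_k\gamma_{kn}(P^{(m)})}{\Gamma+\gamma_{kn}(P^{(m)})}\log\frac{\gamma_{kn}(P)}{\gamma_{kn}(P^{(m)})},\qquad \log 0=-\infty.$$ Write $\phi^{(m)}=\phi(P^{(m)})$. For every sequence of SCALE iterates the following holds. (1) If $f(\phi^{(m+1)})=f(\phi^{(m)})$ for some $m\ge1$, then $\phi^{(m+1)}=\phi^{(m)}\in\mathcal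 S$, and $P^{(m+1)}=P^{(m)}$ satisfies the KKT conditions of the WSR problem. (2) If $f(\phi^{(1)})>f(\phi)$ for every $\phi\in\mathcal S\setminus\Phi^\star$, then $g$ has a maximum $f^\star$ over $\mathcal P$ and $\lim_{m\to\infty}f(\phi^{(m)})=f^\star$. -/

import Mathlib

open Filter Topology

namespace DSM

/-- `K` links, `N` carriers. `gain k l n` is the power gain on carrier `n` from transmitter `l` to
receiver `k`, `noise k n` the noise power, `gap` the SINR gap, `weight k` the rate weight,
`total k` the sum-power budget and `mask k n` the power spectrum mask. -/
structure Model (K N : ℕ) where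
  gain : Fin K → Fin K → Fin N → ℝ
  noise : Fin K → Fin N → ℝ
  gap : ℝ
  weight : Fin K → ℝ
  total : Fin K → ℝ
  mask : Fin K → Fin N → ℝ
  gain_pos : ∀ k l n, 0 < gain k l n
  noise_pos : ∀ k n, 0 < noise k n
  gap_pos : 0 < gap
  weight_pos : ∀ k, 0 < weight k
  total_pos : ∀ k, 0 < total k
  mask_pos : ∀ k n, 0 < mask k n

noncomputable section

namespace Model

variable {K N : ℕ} (S : Model K N)

/-- Interference-plus-noise power at receiver `k` on carrier `n`. -/
def interference (P : Fin K → Fin N → ℝ) (k : Fin K) (n : Fin N) : ℝ :=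
  S.noise k n + ∑ l ∈ Finset.univ.erase k, S.gain k l n * P l n

/-- Signal-to-interference-plus-noise ratio. -/
def sinr (P : Fin K → Fin N → ℝ) (k : Fin K) (n : Fin N) : ℝ :=
  S.gain k k n * P k n / S.interference P k n

/-- Weighted sum rate (WSR) as a function of the power allocation. -/
def wsr (P : Fin K → Fin N → ℝ) : ℝ :=
  ∑ k, ∑ n, S.weight k * Real.log (1 + S.sinr P k n / S.gap)

/-- The feasible power allocations of the WSR problem. -/
def feasible : Set (Fin K → Fin N → ℝ) :=
  {P | (∀ k, ∑ n, P k n ≤ S.total k) ∧ ∀ k n, 0 ≤ P k n ∧ P k n ≤ S.mask k n}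

/-- KKT conditions of the problem of maximizing `wsr` over `feasible`: `lam`, `al`, `be` are the
multipliers of the budget, lower-bound and mask constraints. The partial derivative of `wsr` with
respect to the entry `(k, n)` exists and equals `lam k + be k n - al k n`. -/
def IsKKT (P : Fin K → Fin N → ℝ) : Prop :=
  P ∈ S.feasible ∧
  ∃ (lam : Fin K → ℝ) (al be : Fin K → Fin N → ℝ),
    (∀ k, 0 ≤ lam k) ∧ (∀ k n, 0 ≤ al k n) ∧ (∀ k n, 0 ≤ be k n) ∧
    (∀ k n, HasDerivAt
      (fun x : ℝ => S.wsr (Function.update P k (Function.update (P k) n x)))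
      (lam k + be k n - al k n) (P k n)) ∧
    (∀ k, lam k * (∑ n, P k n - S.total k) = 0) ∧
    (∀ k n, al k n * P k n = 0) ∧
    (∀ k n, be k n * (P k n - S.mask k n) = 0)

/-- The objective of a SCALE iteration at the current allocation `P`, as a function of the new
allocation `R`. The logarithm is extended-real valued: a zero power of `R` gives `-∞`; an entry
where `P` is zero has the coefficient `0` and does not contribute. -/
def surrogate (P R : Fin K → Fin N → ℝ) : EReal :=
  (S.wsr P : EReal) + ∑ k, ∑ n,
    ((S.weight k * S.sinr P k n / (S.gap + S.sinr P k n) : ℝ) : EReal) *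
      ENNReal.log (ENNReal.ofReal (S.sinr R k n / S.sinr P k n))

/-- `P 0, P 1, P 2, …` are the iterates of the SCALE algorithm, started at an entrywise positive
feasible allocation: each iterate is a global maximizer of the surrogate at the previous one. -/
def IsScaleSeq (P : ℕ → Fin K → Fin N → ℝ) : Prop :=
  P 0 ∈ S.feasible ∧ (∀ k n, 0 < P 0 k n) ∧
  ∀ m, P (m + 1) ∈ S.feasible ∧
    ∀ R ∈ S.feasible, S.surrogate (P m) R ≤ S.surrogate (P m) (P (m + 1))

/-- The log-SINR matrix of an allocation; zero power gives `-∞`. -/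
def logSinr (P : Fin K → Fin N → ℝ) : Fin K → Fin N → EReal :=
  fun k n => ENNReal.log (ENNReal.ofReal (S.sinr P k n))

/-- The set of achievable log-SINR matrices. -/
def region : Set (Fin K → Fin N → EReal) := S.logSinr '' S.feasible

/-- The WSR as a function of the log-SINR matrix (no entry of a point of `region` is `+∞`). -/
def logWsr (φ : Fin K → Fin N → EReal) : ℝ :=
  ∑ k, ∑ n, S.weight k * Real.log (1 + (EReal.exp (φ k n)).toReal / S.gap)

/-- The partial derivative of `logWsr` with respect to the entry `(k, n)`; it is `0` at `-∞`. -/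
def gradLogWsr (φ : Fin K → Fin N → EReal) (k : Fin K) (n : Fin N) : ℝ :=
  S.weight k * (EReal.exp (φ k n)).toReal / (S.gap + (EReal.exp (φ k n)).toReal)

/-- The fixed points of the SCALE iteration: `φ` maximizes over `region` the linear form given
by the gradient of the WSR at `φ` (with `0 * (-∞) = 0`). -/
def fixedPoints : Set (Fin K → Fin N → EReal) :=
  {φ | φ ∈ S.region ∧ ∀ ψ ∈ S.region,
    ∑ k, ∑ n, (S.gradLogWsr φ k n : EReal) * ψ k n ≤
      ∑ k, ∑ n, (S.gradLogWsr φ k n : EReal) * φ k n}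

/-- The globally optimal log-SINR matrices. -/
def optimalPoints : Set (Fin K → Fin N → EReal) :=
  {φ | φ ∈ S.region ∧ ∀ ψ ∈ S.region, S.logWsr ψ ≤ S.logWsr φ}

end Model

end

end DSM

namespace DSM

/-! In log-SINR coordinates each rate term is strictly convex, so the surrogate is a tangent
minorant of the WSR, exact only where the SINRs agree (`wsr_add_logForm_sub_le`). A zero power costs
`-∞`, so iterates stay positive, and maximizing the minorant makes the WSR ascend.

If an ascent step is stationary, the SINRs agree, hence the powers agree (`eq_of_sinr_eq`). The
iterate then maximizes its own linear form: it is a fixed point, and since minorant and WSR share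
their derivative there, KKT follows (`isKKT_of_logForm_le`).

For the limit, compactness gives a cluster point `Q`, possibly with zero powers. Monotonicity makes
all rates converge to that of `Q`, so the increments vanish and the maximality inequality passes to
the limit (`IsScaleSeq.exists_limit`). Thus `Q` is a fixed point at least as good as the start, and
the hypothesis of (2) leaves only global optimality. -/

theorem log_one_add_div_tangent {G x y : ℝ} (hG : 0 < G) (hx : 0 < x) (hy : 0 < y) :
    Real.log (1 + x / G) + x / (G + x) * (Real.log y - Real.log x) ≤ Real.log (1 + y / G) ∧
    (Real.log (1 + y / G) ≤ Real.log (1 + x / G) + x / (G + x) * (Real.log y - Real.log x) →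
      y = x) := by
  have hGx : 0 < G + x := by positivity
  have hGy : 0 < G + y := by positivity
  have hlog : ∀ z : ℝ, 0 < z → Real.log (1 + z / G) = Real.log (G + z) - Real.log G := by
    intro z hz
    rw [← Real.log_div (by positivity) hG.ne']
    congr 1
    field_simp
  have hdiff : Real.log (1 + y / G) - Real.log (1 + x / G) = Real.log ((G + y) / (G + x)) := by
    rw [hlog y hy, hlog x hx, Real.log_div hGy.ne' hGx.ne']
    ring
  have hquot : Real.log y - Real.log x = Real.log (y / x) :=
    (Real.log_div hy.ne' hx.ne').symm
  by_cases hxy : y = x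
  · subst hxy
    simp
  · have hne : (1 : ℝ) ≠ y / x := by
      intro h
      apply hxy
      field_simp at h
      exact h.symm
    -- Jensen at the points `1` and `y / x` with weights `G / (G + x)` and `x / (G + x)`, whose mean
    -- is `(G + y) / (G + x)`.
    have key := strictConcaveOn_log_Ioi.2 (Set.mem_Ioi.2 one_pos)
      (Set.mem_Ioi.2 (div_pos hy hx)) hne (div_pos hG hGx) (div_pos hx hGx)
      (by field_simp)
    have harg : (G / (G + x)) • (1 : ℝ) + (x / (G + x)) • (y / x) = (G + y) / (G + x) := by
      simp only [smul_eq_mul]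
      field_simp
    rw [harg, Real.log_one, smul_zero, zero_add, smul_eq_mul, ← hdiff, ← hquot] at key
    exact ⟨by linarith, fun h => by linarith⟩

/-! ### Extended-real linear forms -/

theorem ereal_coe_sum {ι : Type*} (s : Finset ι) (f : ι → ℝ) :
    ((∑ i ∈ s, f i : ℝ) : EReal) = ∑ i ∈ s, (f i : EReal) := by
  classical
  induction s using Finset.induction_on with
  | empty => simp
  | insert a s ha ih => rw [Finset.sum_insert ha, Finset.sum_insert ha, EReal.coe_add, ih]

theorem ereal_sum_eq_bot {ι : Type*} {s : Finset ι} {f : ι → EReal} {i : ι} (hi : i ∈ s)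
    (h : f i = ⊥) : ∑ j ∈ s, f j = ⊥ := by
  classical
  rw [← Finset.add_sum_erase s f hi, h, EReal.bot_add]

/-- At a zero entry the two logarithms differ (`⊥` against `0`), but there the coefficient vanishes
and kills both. -/
theorem sum_coe_mul_log {K N : ℕ} (c x : Fin K → Fin N → ℝ) (hx : ∀ k n, 0 ≤ x k n)
    (h : ∀ k n, c k n ≠ 0 → x k n ≠ 0) :
    ∑ k, ∑ n, (c k n : EReal) * ENNReal.log (ENNReal.ofReal (x k n)) =
      ((∑ k, ∑ n, c k n * Real.log (x k n) : ℝ) : EReal) := by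
  rw [ereal_coe_sum]
  refine Finset.sum_congr rfl fun k _ => ?_
  rw [ereal_coe_sum]
  refine Finset.sum_congr rfl fun n _ => ?_
  by_cases hc : c k n = 0
  · simp [hc]
  · rw [ENNReal.log_ofReal_of_pos ((hx k n).lt_of_ne' (h k n hc)), EReal.coe_mul]

theorem sum_coe_mul_log_eq_bot {K N : ℕ} (c x : Fin K → Fin N → ℝ) {k : Fin K} {n : Fin N}
    (hc : 0 < c k n) (hx : x k n = 0) :
    ∑ k, ∑ n, (c k n : EReal) * ENNReal.log (ENNReal.ofReal (x k n)) = ⊥ := by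
  refine ereal_sum_eq_bot (Finset.mem_univ k) (ereal_sum_eq_bot (Finset.mem_univ n) ?_)
  rw [hx, ENNReal.ofReal_zero, ENNReal.log_zero, EReal.coe_mul_bot_of_pos hc]

/-- Multipliers for the maximization of a linear form over a budget and box constraint. -/
theorem exists_row_multipliers {N : ℕ} {p mask D : Fin N → ℝ} {tot : ℝ} (hp : ∀ n, 0 < p n)
    (hm : ∀ n, p n ≤ mask n) (hsum : ∑ n, p n ≤ tot)
    (h : ∀ v : Fin N → ℝ, ∑ n, (p n + v n) ≤ tot →
      (∀ n, 0 ≤ p n + v n ∧ p n + v n ≤ mask n) → ∑ n, v n * D n ≤ 0) :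
    ∃ (lam : ℝ) (be : Fin N → ℝ), 0 ≤ lam ∧ (∀ n, 0 ≤ be n) ∧ (∀ n, D n = lam + be n) ∧
      lam * (∑ n, p n - tot) = 0 ∧ ∀ n, be n * (p n - mask n) = 0 := by
  have hD : ∀ n, 0 ≤ D n := by
    intro n
    have := h (Pi.single n (-p n)) ?_ ?_
    · simp only [Pi.single_apply, ite_mul, zero_mul, Finset.sum_ite_eq', Finset.mem_univ,
        if_true] at this
      nlinarith [hp n]
    · rw [Finset.sum_add_distrib]
      simp only [Pi.single_apply, Finset.sum_ite_eq', Finset.mem_univ, if_true]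
      linarith [hp n]
    · intro j
      rcases eq_or_ne j n with rfl | hj
      · simp [(hp j).le.trans (hm j)]
      · simp [hj, (hp j).le, hm j]
  rcases hsum.lt_or_eq with hlt | heq
  -- Slack budget: its multiplier is zero, and an entry below its mask could be raised alone, so its
  -- `D n` vanishes.
  · refine ⟨0, D, le_rfl, hD, fun n => (zero_add _).symm, by simp, fun n => ?_⟩
    rcases (hm n).lt_or_eq with hn | hn
    · obtain ⟨t, ht, ht1, ht2⟩ : ∃ t > 0, t ≤ mask n - p n ∧ t ≤ tot - ∑ n, p n :=
        ⟨min (mask n - p n) (tot - ∑ n, p n), lt_min (by linarith) (by linarith),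
          min_le_left _ _, min_le_right _ _⟩
      have := h (Pi.single n t) ?_ ?_
      · simp only [Pi.single_apply, ite_mul, zero_mul, Finset.sum_ite_eq', Finset.mem_univ,
          if_true] at this
        have h0 : D n = 0 := le_antisymm (by nlinarith) (hD n)
        rw [h0, zero_mul]
      · rw [Finset.sum_add_distrib]
        simp only [Pi.single_apply, Finset.sum_ite_eq', Finset.mem_univ, if_true]
        linarith
      · intro j
        rcases eq_or_ne j n with rfl | hj
        · simp only [Pi.single_eq_same]
          constructor <;> linarith [hp j]
        · simp [hj, (hp j).le, hm j]
    · rw [hn, sub_self, mul_zero]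
  · rcases isEmpty_or_nonempty (Fin N) with hN | hN
    · exact ⟨0, 0, le_rfl, fun n => le_rfl, fun n => hN.elim n, by simp, fun n => hN.elim n⟩
    -- Tight budget: the price is the least `D m`. An entry below its mask with larger `D n` would
    -- gain by taking power from `m`.
    obtain ⟨m, hmin⟩ := Finite.exists_min D
    refine ⟨D m, fun n => D n - D m, hD m, fun n => sub_nonneg.2 (hmin n), fun n => by ring,
      by rw [heq, sub_self, mul_zero], fun n => ?_⟩
    rcases (hm n).lt_or_eq with hn | hn
    · rcases eq_or_ne n m with rfl | hnm
      · simp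
      obtain ⟨t, ht, ht1, ht2⟩ : ∃ t > 0, t ≤ mask n - p n ∧ t ≤ p m :=
        ⟨min (mask n - p n) (p m), lt_min (by linarith) (hp m),
          min_le_left _ _, min_le_right _ _⟩
      have := h (Pi.single n t + Pi.single m (-t)) ?_ ?_
      · simp only [Pi.add_apply, Pi.single_apply, add_mul, ite_mul, zero_mul,
          Finset.sum_add_distrib, Finset.sum_ite_eq', Finset.mem_univ, if_true] at this
        have h0 : D n = D m := le_antisymm (by nlinarith) (hmin n)
        simp [h0]
      · simp only [Pi.add_apply, Pi.single_apply,
          Finset.sum_add_distrib, Finset.sum_ite_eq', Finset.mem_univ, if_true]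
        linarith
      · intro j
        rcases eq_or_ne j n with rfl | hj
        · simp only [Pi.add_apply, Pi.single_eq_same, Pi.single_eq_of_ne hnm, add_zero]
          constructor <;> linarith [hp j]
        · rcases eq_or_ne j m with rfl | hjm
          · simp only [Pi.add_apply, Pi.single_eq_same, Pi.single_eq_of_ne hj, zero_add]
            constructor <;> linarith [hp j, hm j]
          · simp [hj, hjm, (hp j).le, hm j]
    · rw [hn, sub_self, mul_zero]

noncomputable section

namespace Model

variable {K N : ℕ} (S : Model K N)

/-- The derivative of the weighted sum rate with respect to the log-SINR at an allocation. -/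
def slope (P : Fin K → Fin N → ℝ) (k : Fin K) (n : Fin N) : ℝ :=
  S.weight k * S.sinr P k n / (S.gap + S.sinr P k n)

/-- A linear form in the log-SINR matrix, with `Real.log`. -/
def logForm (c : Fin K → Fin N → ℝ) (R : Fin K → Fin N → ℝ) : ℝ :=
  ∑ k, ∑ n, c k n * Real.log (S.sinr R k n)

variable {P Q R : Fin K → Fin N → ℝ}

/-! ### Signs, feasible set and regularity -/

theorem interference_pos (hP : ∀ k n, 0 ≤ P k n) (k : Fin K) (n : Fin N) :
    0 < S.interference P k n :=
  add_pos_of_pos_of_nonneg (S.noise_pos k n)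
    (Finset.sum_nonneg fun l _ => mul_nonneg (S.gain_pos k l n).le (hP l n))

theorem sinr_nonneg (hP : ∀ k n, 0 ≤ P k n) (k : Fin K) (n : Fin N) : 0 ≤ S.sinr P k n :=
  div_nonneg (mul_nonneg (S.gain_pos k k n).le (hP k n)) (S.interference_pos hP k n).le

theorem sinr_pos (hP : ∀ k n, 0 < P k n) (k : Fin K) (n : Fin N) : 0 < S.sinr P k n :=
  div_pos (mul_pos (S.gain_pos k k n) (hP k n)) (S.interference_pos (fun k n => (hP k n).le) k n)

theorem sinr_eq_zero {k : Fin K} {n : Fin N} (h : P k n = 0) : S.sinr P k n = 0 := by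
  simp [sinr, h]

theorem slope_nonneg (hP : ∀ k n, 0 ≤ P k n) (k : Fin K) (n : Fin N) : 0 ≤ S.slope P k n :=
  div_nonneg (mul_nonneg (S.weight_pos k).le (S.sinr_nonneg hP k n))
    (add_nonneg S.gap_pos.le (S.sinr_nonneg hP k n))

theorem slope_pos (hP : ∀ k n, 0 < P k n) (k : Fin K) (n : Fin N) : 0 < S.slope P k n :=
  div_pos (mul_pos (S.weight_pos k) (S.sinr_pos hP k n))
    (add_pos S.gap_pos (S.sinr_pos hP k n))

theorem sinr_ne_zero_of_slope_ne_zero {k : Fin K} {n : Fin N} (h : S.slope P k n ≠ 0) :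
    S.sinr P k n ≠ 0 := by
  intro h0
  exact h (by simp [slope, h0])

theorem toReal_exp_logSinr (hP : ∀ k n, 0 ≤ P k n) (k : Fin K) (n : Fin N) :
    (EReal.exp (S.logSinr P k n)).toReal = S.sinr P k n := by
  rw [logSinr, ENNReal.exp_log, ENNReal.toReal_ofReal (S.sinr_nonneg hP k n)]

theorem logWsr_logSinr (hP : ∀ k n, 0 ≤ P k n) : S.logWsr (S.logSinr P) = S.wsr P := by
  simp only [logWsr, wsr, S.toReal_exp_logSinr hP]

theorem gradLogWsr_logSinr (hP : ∀ k n, 0 ≤ P k n) (k : Fin K) (n : Fin N) :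
    S.gradLogWsr (S.logSinr P) k n = S.slope P k n := by
  simp only [gradLogWsr, slope, S.toReal_exp_logSinr hP]

theorem convex_feasible : Convex ℝ S.feasible := by
  intro P hP Q hQ a b ha hb hab
  refine ⟨fun k => ?_, fun k n => ⟨?_, ?_⟩⟩
  · simp only [Pi.add_apply, Pi.smul_apply, smul_eq_mul, Finset.sum_add_distrib,
      ← Finset.mul_sum]
    calc a * ∑ n, P k n + b * ∑ n, Q k n ≤ a * S.total k + b * S.total k := by
          gcongr
          · exact hP.1 k
          · exact hQ.1 k
      _ = S.total k := by rw [← add_mul, hab, one_mul]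
  · have h1 := (hP.2 k n).1
    have h2 := (hQ.2 k n).1
    simp only [Pi.add_apply, Pi.smul_apply, smul_eq_mul]
    positivity
  · simp only [Pi.add_apply, Pi.smul_apply, smul_eq_mul]
    calc a * P k n + b * Q k n ≤ a * S.mask k n + b * S.mask k n := by
          gcongr
          · exact (hP.2 k n).2
          · exact (hQ.2 k n).2
      _ = S.mask k n := by rw [← add_mul, hab, one_mul]

theorem isCompact_feasible : IsCompact S.feasible := by
  have hsub : S.feasible ⊆ Set.Icc 0 S.mask := fun P hP =>
    ⟨fun k n => (hP.2 k n).1, fun k n => (hP.2 k n).2⟩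
  refine isCompact_Icc.of_isClosed_subset ?_ hsub
  have : S.feasible = (⋂ k, {P | ∑ n, P k n ≤ S.total k}) ∩
      ⋂ k, ⋂ n, ({P | 0 ≤ P k n} ∩ {P | P k n ≤ S.mask k n}) := by
    ext P
    simp [feasible]
  rw [this]
  refine (isClosed_iInter fun k => isClosed_le (by fun_prop) (by fun_prop)).inter
    (isClosed_iInter fun k => isClosed_iInter fun n =>
      (isClosed_le (by fun_prop) (by fun_prop)).inter (isClosed_le (by fun_prop) (by fun_prop)))

theorem differentiableAt_sinr (hP : ∀ k n, 0 ≤ P k n) (k : Fin K) (n : Fin N) :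
    DifferentiableAt ℝ (fun R => S.sinr R k n) P := by
  have h := (S.interference_pos hP k n).ne'
  have hn : DifferentiableAt ℝ (fun R : Fin K → Fin N → ℝ => S.gain k k n * R k n) P := by
    fun_prop
  have hd : DifferentiableAt ℝ (fun R => S.interference R k n) P := by
    unfold interference
    fun_prop
  simpa only [sinr, div_eq_mul_inv] using hn.fun_mul (hd.fun_inv h)

theorem continuousAt_sinr (hP : ∀ k n, 0 ≤ P k n) (k : Fin K) (n : Fin N) :
    ContinuousAt (fun R => S.sinr R k n) P :=
  (S.differentiableAt_sinr hP k n).continuousAt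

theorem differentiableAt_wsr (hP : ∀ k n, 0 ≤ P k n) : DifferentiableAt ℝ S.wsr P := by
  unfold wsr
  refine DifferentiableAt.fun_sum fun k _ => DifferentiableAt.fun_sum fun n _ => ?_
  have h1 := S.differentiableAt_sinr hP k n
  have h2 : 1 + S.sinr P k n / S.gap ≠ 0 :=
    (add_pos_of_pos_of_nonneg one_pos (div_nonneg (S.sinr_nonneg hP k n) S.gap_pos.le)).ne'
  have h3 : DifferentiableAt ℝ (fun R => 1 + S.sinr R k n / S.gap) P := by fun_prop
  exact (h3.log h2).const_mul _

theorem differentiableAt_logForm (c : Fin K → Fin N → ℝ) (hP : ∀ k n, 0 < P k n) :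
    DifferentiableAt ℝ (S.logForm c) P := by
  unfold logForm
  refine DifferentiableAt.fun_sum fun k _ => DifferentiableAt.fun_sum fun n _ => ?_
  exact ((S.differentiableAt_sinr (fun k n => (hP k n).le) k n).log
    (S.sinr_pos hP k n).ne').const_mul _

theorem continuousAt_slope (hP : ∀ k n, 0 ≤ P k n) (k : Fin K) (n : Fin N) :
    ContinuousAt (fun R => S.slope R k n) P := by
  have h := S.continuousAt_sinr hP k n
  exact (h.const_mul _).div (h.const_add _)
    (add_pos_of_pos_of_nonneg S.gap_pos (S.sinr_nonneg hP k n)).ne'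

/-- The linear form of an allocation at its own log-SINR matrix is continuous up to the boundary. -/
theorem continuousAt_logForm_slope (hP : ∀ k n, 0 ≤ P k n) :
    ContinuousAt (fun R => S.logForm (S.slope R) R) P := by
  have hform : (fun R => S.logForm (S.slope R) R) = fun R => ∑ k, ∑ n,
      S.weight k / (S.gap + S.sinr R k n) * (S.sinr R k n * Real.log (S.sinr R k n)) := by
    funext R
    refine Finset.sum_congr rfl fun k _ => Finset.sum_congr rfl fun n _ => ?_
    rw [slope]
    ring
  -- Written this way, the singular factor is `x * log x`, which is continuous at zero.
  rw [hform]
  refine tendsto_finsetSum _ fun k _ => tendsto_finsetSum _ fun n _ => ?_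
  have h := S.continuousAt_sinr hP k n
  exact Tendsto.mul (tendsto_const_nhds.div (h.const_add _)
    (add_pos_of_pos_of_nonneg S.gap_pos (S.sinr_nonneg hP k n)).ne')
    ((Real.continuous_mul_log.tendsto _).comp h)

theorem continuousAt_logForm_left (R : Fin K → Fin N → ℝ) (hP : ∀ k n, 0 ≤ P k n) :
    ContinuousAt (fun Q => S.logForm (S.slope Q) R) P :=
  tendsto_finsetSum _ fun k _ => tendsto_finsetSum _ fun n _ =>
    (S.continuousAt_slope hP k n).mul_const _

/-! ### Tangent minorant and injectivity of the SINR map -/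

theorem wsr_add_logForm_sub_le (hP : ∀ k n, 0 < P k n) (hR : ∀ k n, 0 < R k n) :
    S.wsr P + (S.logForm (S.slope P) R - S.logForm (S.slope P) P) ≤ S.wsr R ∧
    (S.wsr R ≤ S.wsr P + (S.logForm (S.slope P) R - S.logForm (S.slope P) P) →
      S.sinr R = S.sinr P) := by
  set a : Fin K → Fin N → ℝ := fun k n => S.weight k * Real.log (1 + S.sinr R k n / S.gap) with ha
  set b : Fin K → Fin N → ℝ := fun k n => S.weight k * Real.log (1 + S.sinr P k n / S.gap) +
    (S.slope P k n * Real.log (S.sinr R k n) - S.slope P k n * Real.log (S.sinr P k n)) with hb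
  have hb' : ∀ k n, b k n = S.weight k * (Real.log (1 + S.sinr P k n / S.gap) +
      S.sinr P k n / (S.gap + S.sinr P k n) *
        (Real.log (S.sinr R k n) - Real.log (S.sinr P k n))) := by
    intro k n
    simp only [hb, slope]
    ring
  have hA : S.wsr R = ∑ k, ∑ n, a k n := rfl
  have hB : S.wsr P + (S.logForm (S.slope P) R - S.logForm (S.slope P) P) =
      ∑ k, ∑ n, b k n := by
    simp only [wsr, logForm, hb, Finset.sum_add_distrib, Finset.sum_sub_distrib]
  have hsc := fun k n => log_one_add_div_tangent S.gap_pos (S.sinr_pos hP k n) (S.sinr_pos hR k n)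
  have hle : ∀ k n, b k n ≤ a k n := fun k n => by
    rw [hb']
    exact mul_le_mul_of_nonneg_left (hsc k n).1 (S.weight_pos k).le
  rw [hA, hB]
  refine ⟨Finset.sum_le_sum fun k _ => Finset.sum_le_sum fun n _ => hle k n, fun h => ?_⟩
  have heq := le_antisymm (Finset.sum_le_sum fun k _ => Finset.sum_le_sum fun n _ => hle k n) h
  rw [Finset.sum_eq_sum_iff_of_le fun k _ => Finset.sum_le_sum fun n _ => hle k n] at heq
  funext k n
  have hk := heq k (Finset.mem_univ k)
  rw [Finset.sum_eq_sum_iff_of_le fun n _ => hle k n] at hk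
  have hkn := hk n (Finset.mem_univ n)
  refine (hsc k n).2 ?_
  rw [hb'] at hkn
  exact (mul_left_cancel₀ (S.weight_pos k).ne' hkn).ge

/-- Take the largest ratio `t` of powers on carrier `n`, attained at link `j`. If `t > 1`, the
signal of `j` grows by exactly `t` but its interference by less, since the noise is not scaled; the
SINRs of `j` would differ. -/
theorem le_of_sinr_eq (hP : ∀ k n, 0 < P k n) (hQ : ∀ k n, 0 < Q k n)
    (h : S.sinr P = S.sinr Q) (k : Fin K) (n : Fin N) : P k n ≤ Q k n := by
  have : Nonempty (Fin K) := ⟨k⟩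
  obtain ⟨j, hj⟩ := Finite.exists_max fun k => P k n / Q k n
  set t := P j n / Q j n with ht
  have hle : ∀ l, P l n ≤ t * Q l n := fun l => (div_le_iff₀ (hQ l n)).1 (hj l)
  suffices ht1 : t ≤ 1 by
    exact (hle k).trans (mul_le_of_le_one_left (hQ k n).le ht1)
  by_contra! hlt
  have hIP := S.interference_pos (fun k n => (hP k n).le) j n
  have hIQ := S.interference_pos (fun k n => (hQ k n).le) j n
  have hI : S.interference P j n < t * S.interference Q j n := by
    simp only [interference, mul_add, Finset.mul_sum]
    refine add_lt_add_of_lt_of_le (lt_mul_of_one_lt_left (S.noise_pos j n) hlt)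
      (Finset.sum_le_sum fun l _ => ?_)
    calc S.gain j l n * P l n ≤ S.gain j l n * (t * Q l n) :=
          mul_le_mul_of_nonneg_left (hle l) (S.gain_pos j l n).le
      _ = t * (S.gain j l n * Q l n) := by ring
  have hs := congrFun (congrFun h j) n
  have hPj : P j n = t * Q j n := by rw [ht, div_mul_cancel₀ _ (hQ j n).ne']
  rw [sinr, sinr, div_eq_div_iff hIP.ne' hIQ.ne', hPj] at hs
  have hgq : 0 < S.gain j j n * Q j n := mul_pos (S.gain_pos j j n) (hQ j n)
  have := mul_lt_mul_of_pos_left hI hgq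
  linarith [hs, this]

theorem eq_of_sinr_eq (hP : ∀ k n, 0 < P k n) (hQ : ∀ k n, 0 < Q k n)
    (h : S.sinr P = S.sinr Q) : P = Q := by
  funext k n
  exact le_antisymm (S.le_of_sinr_eq hP hQ h k n) (S.le_of_sinr_eq hQ hP h.symm k n)

/-- Testing against positive allocations suffices: any other competitor either has value `⊥` or is a
limit, along the segment towards the positive point `Q`, of positive ones with converging values. -/
theorem logSinr_mem_fixedPoints (hQ : Q ∈ S.feasible) (hQ0 : ∀ k n, 0 < Q k n)
    (hP : P ∈ S.feasible) (h : ∀ R ∈ S.feasible, (∀ k n, 0 < R k n) →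
      S.logForm (S.slope P) R ≤ S.logForm (S.slope P) P) :
    S.logSinr P ∈ S.fixedPoints := by
  refine ⟨⟨P, hP, rfl⟩, ?_⟩
  rintro _ ⟨R, hR, rfl⟩
  have hP0 := fun k n => (hP.2 k n).1
  have hR0 := fun k n => (hR.2 k n).1
  simp only [S.gradLogWsr_logSinr hP0, logSinr]
  by_cases hz : ∀ k n, S.slope P k n ≠ 0 → S.sinr R k n ≠ 0
  · rw [sum_coe_mul_log _ _ (S.sinr_nonneg hR0) hz, sum_coe_mul_log _ _ (S.sinr_nonneg hP0)
      fun k n => S.sinr_ne_zero_of_slope_ne_zero, EReal.coe_le_coe_iff]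
    let γ : ℝ → Fin K → Fin N → ℝ := fun t => (1 - t) • R + t • Q
    have hγ0 : γ 0 = R := by simp [γ]
    have hγ : Tendsto γ (𝓝[>] 0) (𝓝 R) := by
      have hc : Continuous γ := by fun_prop
      have := (hc.tendsto 0).mono_left (nhdsWithin_le_nhds (s := Set.Ioi 0))
      rwa [hγ0] at this
    have hlim : Tendsto (fun t => S.logForm (S.slope P) (γ t)) (𝓝[>] 0)
        (𝓝 (S.logForm (S.slope P) R)) := by
      refine tendsto_finsetSum _ fun k _ => tendsto_finsetSum _ fun n _ => ?_
      by_cases hc : S.slope P k n = 0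
      · simp [hc]
      · exact (((S.continuousAt_sinr hR0 k n).tendsto.comp hγ).log (hz k n hc)).const_mul _
    refine le_of_tendsto hlim ?_
    have hev : ∀ᶠ t : ℝ in 𝓝[>] 0, t ∈ Set.Ioo (0 : ℝ) 1 :=
      Ioo_mem_nhdsGT one_pos
    filter_upwards [hev] with t ht
    refine h _ (S.convex_feasible hR hQ (by linarith [ht.2]) ht.1.le (by ring)) fun k n => ?_
    simp only [γ, Pi.add_apply, Pi.smul_apply, smul_eq_mul]
    exact add_pos_of_nonneg_of_pos (mul_nonneg (by linarith [ht.2]) (hR0 k n))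
      (mul_pos ht.1 (hQ0 k n))
  · push Not at hz
    obtain ⟨k, n, hc, hx⟩ := hz
    rw [sum_coe_mul_log_eq_bot _ _ ((S.slope_nonneg hP0 k n).lt_of_ne' hc) hx]
    exact bot_le

/-! ### The surrogate, and KKT from stationarity -/

theorem surrogate_eq_coe (hP : ∀ k n, 0 < P k n) (hR : ∀ k n, 0 < R k n) :
    S.surrogate P R =
      ((S.wsr P + (S.logForm (S.slope P) R - S.logForm (S.slope P) P) : ℝ) : EReal) := by
  have hpos := fun k n => div_pos (S.sinr_pos hR k n) (S.sinr_pos hP k n)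
  have := sum_coe_mul_log (S.slope P) (fun k n => S.sinr R k n / S.sinr P k n)
    (fun k n => (hpos k n).le) (fun k n _ => (hpos k n).ne')
  rw [EReal.coe_add]
  refine congrArg _ (this.trans ?_)
  simp only [logForm, ← Finset.sum_sub_distrib, ← mul_sub,
    Real.log_div (S.sinr_pos hR _ _).ne' (S.sinr_pos hP _ _).ne']

theorem surrogate_eq_bot (hP : ∀ k n, 0 < P k n) {k : Fin K} {n : Fin N} (h : R k n = 0) :
    S.surrogate P R = ⊥ := by
  have := sum_coe_mul_log_eq_bot (S.slope P) (fun k n => S.sinr R k n / S.sinr P k n)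
    (S.slope_pos hP k n) (by rw [S.sinr_eq_zero h, zero_div])
  exact (congrArg _ this).trans (EReal.add_bot _)

theorem pos_of_surrogate_max (hP : P ∈ S.feasible) (hP0 : ∀ k n, 0 < P k n)
    (hQ : Q ∈ S.feasible) (h : ∀ R ∈ S.feasible, S.surrogate P R ≤ S.surrogate P Q)
    (k : Fin K) (n : Fin N) : 0 < Q k n := by
  refine (hQ.2 k n).1.lt_of_ne' fun h0 => ?_
  have := h P hP
  rw [S.surrogate_eq_bot hP0 h0, S.surrogate_eq_coe hP0 hP0, le_bot_iff] at this
  exact EReal.coe_ne_bot _ this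

theorem logForm_le_of_surrogate_max (hP0 : ∀ k n, 0 < P k n)
    (hQ0 : ∀ k n, 0 < Q k n) (h : ∀ R ∈ S.feasible, S.surrogate P R ≤ S.surrogate P Q)
    (hR : R ∈ S.feasible) (hR0 : ∀ k n, 0 < R k n) :
    S.logForm (S.slope P) R ≤ S.logForm (S.slope P) Q := by
  have := h R hR
  rw [S.surrogate_eq_coe hP0 hR0, S.surrogate_eq_coe hP0 hQ0, EReal.coe_le_coe_iff] at this
  linarith

theorem isKKT_of_logForm_le (hP : P ∈ S.feasible) (hP0 : ∀ k n, 0 < P k n)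
    (h : ∀ R ∈ S.feasible, (∀ k n, 0 < R k n) →
      S.logForm (S.slope P) R ≤ S.logForm (S.slope P) P) : S.IsKKT P := by
  have hev : ∀ᶠ R in 𝓝 P, ∀ k n, 0 < R k n :=
    eventually_all.2 fun k => eventually_all.2 fun n => by
      have hc : Continuous fun R : Fin K → Fin N → ℝ => R k n := by fun_prop
      exact hc.continuousAt.eventually_const_lt (hP0 k n)
  have hW := (S.differentiableAt_wsr fun k n => (hP0 k n).le).hasFDerivAt
  have hL := (S.differentiableAt_logForm (S.slope P) hP0).hasFDerivAt
  set W := fderiv ℝ S.wsr P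
  set L := fderiv ℝ (S.logForm (S.slope P)) P
  -- The minorant touches the WSR at `P`, so the difference has a local minimum there and the
  -- derivatives coincide.
  have hWL : W - L = 0 := by
    refine IsLocalMin.hasFDerivAt_eq_zero (f := fun R => S.wsr R - S.logForm (S.slope P) R)
      ?_ (hW.sub hL)
    filter_upwards [hev] with R hR
    linarith [(S.wsr_add_logForm_sub_le hP0 hR).1]
  have hdir : ∀ R ∈ S.feasible, W (R - P) ≤ 0 := by
    intro R hR
    rw [sub_eq_zero.1 hWL]
    refine IsLocalMaxOn.hasFDerivWithinAt_nonpos (s := S.feasible) ?_ hL.hasFDerivWithinAt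
      (sub_mem_posTangentConeAt_of_segment_subset (S.convex_feasible.segment_subset hP hR))
    filter_upwards [mem_nhdsWithin_of_mem_nhds hev, self_mem_nhdsWithin] with R hR hRf
    exact h R hRf hR
  let D : Fin K → Fin N → ℝ := fun k n => W (Pi.single k (Pi.single n 1))
  have hlin : ∀ k (v : Fin N → ℝ), W (Pi.single k v) = ∑ n, v n * D k n := by
    intro k v
    have hv : Pi.single k v = ∑ n, v n • (Pi.single k (Pi.single n 1) : Fin K → Fin N → ℝ) := by
      funext j m
      rcases eq_or_ne j k with rfl | hj
      · simp [Finset.sum_apply, Pi.single_apply]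
      · simp [Finset.sum_apply, hj]
    rw [hv, map_sum]
    simp only [map_smul, smul_eq_mul, D]
  have hrow : ∀ k, ∃ (lam : ℝ) (be : Fin N → ℝ), 0 ≤ lam ∧ (∀ n, 0 ≤ be n) ∧
      (∀ n, D k n = lam + be n) ∧ lam * (∑ n, P k n - S.total k) = 0 ∧
      ∀ n, be n * (P k n - S.mask k n) = 0 := by
    intro k
    refine exists_row_multipliers (hP0 k) (fun n => (hP.2 k n).2) (hP.1 k) fun v hv1 hv2 => ?_
    rw [← hlin]
    have := hdir (P + Pi.single k v) ⟨fun j => ?_, fun j n => ?_⟩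
    · rwa [add_sub_cancel_left] at this
    · rcases eq_or_ne j k with rfl | hj
      · simpa using hv1
      · simpa [hj] using hP.1 j
    · rcases eq_or_ne j k with rfl | hj
      · simpa using hv2 n
      · simpa [hj] using hP.2 j n
  choose lam be hlam hbe hD htot hmask using hrow
  -- All powers are positive, so the lower-bound multipliers are zero.
  refine ⟨hP, lam, 0, be, hlam, fun k n => le_rfl, hbe, fun k n => ?_, htot, by simp, hmask⟩
  have hpath : HasDerivAt
      (fun x : ℝ => Function.update P k (Function.update (P k) n x))
      (Pi.single k (Pi.single n 1)) (P k n) := by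
    have h1 : (fun x : ℝ => Function.update P k (Function.update (P k) n x)) = fun x =>
        P + (x - P k n) • (Pi.single k (Pi.single n 1) : Fin K → Fin N → ℝ) := by
      funext x j m
      rcases eq_or_ne j k with rfl | hj
      · rcases eq_or_ne m n with rfl | hm
        · simp
        · simp [hm]
      · simp [hj]
    rw [h1]
    simpa using (((hasDerivAt_id (P k n)).sub_const (P k n)).smul_const
      (Pi.single k (Pi.single n 1) : Fin K → Fin N → ℝ)).const_add P
  have hW' : HasFDerivAt S.wsr W (Function.update P k (Function.update (P k) n (P k n))) := by
    simpa using hW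
  have := hW'.comp_hasDerivAt (P k n) hpath
  have hval : lam k + be k n - (0 : Fin K → Fin N → ℝ) k n = W (Pi.single k (Pi.single n 1)) := by
    rw [← hD k n]
    simp [D]
  rw [hval]
  exact this

end Model

end

end DSM

namespace DSM

namespace Model

variable {K N : ℕ} (S : Model K N) {P : ℕ → Fin K → Fin N → ℝ}

/-! ### Ascent and limit points of the iterates -/

theorem IsScaleSeq.mem_feasible (hP : S.IsScaleSeq P) : ∀ m, P m ∈ S.feasible
  | 0 => hP.1
  | m + 1 => (hP.2.2 m).1

theorem IsScaleSeq.pos (hP : S.IsScaleSeq P) (m : ℕ) : ∀ k n, 0 < P m k n := by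
  induction m with
  | zero => exact hP.2.1
  | succ m ih =>
    exact S.pos_of_surrogate_max (IsScaleSeq.mem_feasible S hP m) ih (hP.2.2 m).1 (hP.2.2 m).2

theorem IsScaleSeq.logForm_le (hP : S.IsScaleSeq P) (m : ℕ) {R : Fin K → Fin N → ℝ}
    (hR : R ∈ S.feasible) (hR0 : ∀ k n, 0 < R k n) :
    S.logForm (S.slope (P m)) R ≤ S.logForm (S.slope (P m)) (P (m + 1)) :=
  S.logForm_le_of_surrogate_max (IsScaleSeq.pos S hP m) (IsScaleSeq.pos S hP (m + 1))
    (hP.2.2 m).2 hR hR0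

theorem IsScaleSeq.monotone_wsr (hP : S.IsScaleSeq P) : Monotone fun m => S.wsr (P m) := by
  refine monotone_nat_of_le_succ fun m => ?_
  have h1 := IsScaleSeq.logForm_le S hP m (IsScaleSeq.mem_feasible S hP m) (IsScaleSeq.pos S hP m)
  have h2 := (S.wsr_add_logForm_sub_le (IsScaleSeq.pos S hP m) (IsScaleSeq.pos S hP (m + 1))).1
  linarith

theorem IsScaleSeq.eq_and_fixed (hP : S.IsScaleSeq P) {m : ℕ}
    (h : S.wsr (P (m + 1)) = S.wsr (P m)) :
    P (m + 1) = P m ∧ S.logSinr (P m) ∈ S.fixedPoints ∧ S.IsKKT (P m) := by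
  have hpos := IsScaleSeq.pos S hP
  have hmem := IsScaleSeq.mem_feasible S hP
  have h1 := IsScaleSeq.logForm_le S hP m (hmem m) (hpos m)
  have hs := (S.wsr_add_logForm_sub_le (hpos m) (hpos (m + 1))).2 (by linarith)
  have heq := S.eq_of_sinr_eq (hpos (m + 1)) (hpos m) hs
  have hst : ∀ R ∈ S.feasible, (∀ k n, 0 < R k n) →
      S.logForm (S.slope (P m)) R ≤ S.logForm (S.slope (P m)) (P m) := by
    intro R hR hR0
    have := IsScaleSeq.logForm_le S hP m hR hR0
    rwa [heq] at this
  exact ⟨heq, S.logSinr_mem_fixedPoints (hmem m) (hpos m) (hmem m) hst,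
    S.isKKT_of_logForm_le (hmem m) (hpos m) hst⟩

/-- Some limit point of the iterates is a fixed point, and the rates converge to its rate. -/
theorem IsScaleSeq.exists_limit (hP : S.IsScaleSeq P) :
    ∃ Q ∈ S.feasible, S.logSinr Q ∈ S.fixedPoints ∧
      Tendsto (fun m => S.wsr (P m)) atTop (𝓝 (S.wsr Q)) ∧ ∀ m, S.wsr (P m) ≤ S.wsr Q := by
  have hpos := IsScaleSeq.pos S hP
  have hmem := IsScaleSeq.mem_feasible S hP
  have hmono := IsScaleSeq.monotone_wsr S hP
  obtain ⟨Q, hQ, u, hu, hlim⟩ := S.isCompact_feasible.tendsto_subseq hmem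
  have hQ0 := fun k n => (hQ.2 k n).1
  have hsub : Tendsto (fun m => S.wsr (P (u m))) atTop (𝓝 (S.wsr Q)) :=
    (S.differentiableAt_wsr hQ0).continuousAt.tendsto.comp hlim
  have hwsr : Tendsto (fun m => S.wsr (P m)) atTop (𝓝 (S.wsr Q)) :=
    (tendsto_iff_tendsto_subseq_of_monotone hmono hu.tendsto_atTop).2 hsub
  refine ⟨Q, hQ, ?_, hwsr, hmono.ge_of_tendsto hwsr⟩
  refine S.logSinr_mem_fixedPoints (hmem 0) (hpos 0) hQ fun R hR hR0 => ?_
  have hgap : Tendsto (fun m => S.wsr (P (u m + 1)) - S.wsr (P (u m))) atTop (𝓝 0) := by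
    have := ((tendsto_add_atTop_iff_nat 1).2 hwsr).sub hwsr
    rw [sub_self] at this
    exact this.comp hu.tendsto_atTop
  have hl : Tendsto (fun m => S.logForm (S.slope (P (u m))) R) atTop
      (𝓝 (S.logForm (S.slope Q) R)) :=
    (S.continuousAt_logForm_left R hQ0).tendsto.comp hlim
  -- The increment of the WSR bounds the gain of the form from `P (u m)` to `P (u m + 1)`; hence no
  -- convergence of the shifted subsequence is needed.
  have hr : Tendsto (fun m => S.logForm (S.slope (P (u m))) (P (u m)) +
      (S.wsr (P (u m + 1)) - S.wsr (P (u m)))) atTop (𝓝 (S.logForm (S.slope Q) Q)) := by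
    have := ((S.continuousAt_logForm_slope hQ0).tendsto.comp hlim).add hgap
    rwa [add_zero] at this
  refine le_of_tendsto_of_tendsto' hl hr fun m => ?_
  have h1 := IsScaleSeq.logForm_le S hP (u m) hR hR0
  have h2 := (S.wsr_add_logForm_sub_le (hpos (u m)) (hpos (u m + 1))).1
  linarith

end Model

end DSM

theorem theorem1 {K N : ℕ} (S : DSM.Model K N) (P : ℕ → Fin K → Fin N → ℝ)
    (hP : S.IsScaleSeq P) :
    (∀ m, S.logWsr (S.logSinr (P (m + 1))) = S.logWsr (S.logSinr (P m)) →
      S.logSinr (P (m + 1)) = S.logSinr (P m) ∧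
      S.logSinr (P m) ∈ S.fixedPoints ∧
      P (m + 1) = P m ∧
      S.IsKKT (P m)) ∧
    ((∀ φ ∈ S.fixedPoints \ S.optimalPoints, S.logWsr φ < S.logWsr (S.logSinr (P 0))) →
      ∃ fopt : ℝ, IsGreatest (S.wsr '' S.feasible) fopt ∧
        Tendsto (fun m => S.logWsr (S.logSinr (P m))) atTop (𝓝 fopt)) := by
  have hlog : ∀ R ∈ S.feasible, S.logWsr (S.logSinr R) = S.wsr R := fun R hR =>
    S.logWsr_logSinr fun k n => (hR.2 k n).1
  have hmem := DSM.Model.IsScaleSeq.mem_feasible S hP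
  have hiter : ∀ m, S.logWsr (S.logSinr (P m)) = S.wsr (P m) := fun m => hlog _ (hmem m)
  simp only [hiter]
  refine ⟨fun m hm => ?_, fun h => ?_⟩
  · obtain ⟨heq, hfix, hkkt⟩ := DSM.Model.IsScaleSeq.eq_and_fixed S hP hm
    exact ⟨by rw [heq], hfix, heq, hkkt⟩
  · obtain ⟨Q, hQ, hfix, hlim, hle⟩ := DSM.Model.IsScaleSeq.exists_limit S hP
    refine ⟨S.wsr Q, ⟨⟨Q, hQ, rfl⟩, ?_⟩, hlim⟩
    rintro _ ⟨R, hR, rfl⟩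
    -- A non-optimal fixed point would have a rate strictly below the initial one, which the ascent
    -- excludes.
    have hopt : S.logSinr Q ∈ S.optimalPoints := by
      by_contra hno
      have := h _ ⟨hfix, hno⟩
      rw [hlog Q hQ] at this
      exact this.not_ge (hle 0)
    have := hopt.2 _ ⟨R, hR, rfl⟩
    rwa [hlog R hR, hlog Q hQ] at this
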